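/- Let $T=T_{6,2,2,\dots}$ be the rooted tree whose root has $6$ children and in which every other vertex has $2$ children, and let $\mathrm{Aut}(T)$ be the group of its graph automorphisms fixing the root. Let $X=\{1,\dots,6\}$ be the first level of $T$; each subtree rooted at a vertex of $X$ is identified with $T_{2,2,\dots}$. Let $H\le\mathrm{Sym}(X)$ be generated by $\alpha=(1,3,5)(2,4,6)$ and $\beta_r=(1,2)(3,4)$. Let $s\in \mathrm{Aut}(T_{2,2,\dots})$ be the adding machine, i.e. the automorphism by which the generator $1\in\mathbb Z$ acts on the tree of cosets of the subgroups $2^n\mathbb Z$, $n\ge 0$. For $\pi\in\mathrm{Sym}(X)$ let $\bar\pi\in\mathrm{Aut}(T)$ be the automorphism permuting the six first-level subtrees by $\pi$ without changing the rest of the labels, and let $\bar s\in\mathrm{Aut}(T)$ be the automorphism that fixes $X$ pointwise and acts as $s$ on each of the six first-level subtrees. Let $G\le\mathrm{Aut}(T)$ be the subgroup generated by $\bar\alpha$, $\bar\beta_r$ and $\bar s$. Let $\rho$ be the unitary representation of $G$ on $\ell^2(T^0)$, where $T^0$ is the vertex set of $T$, given by $(\rho(g)\xi)(v)=\xi(g^{-1}v)$,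 and let $\lambda$ be the left regular representation of $G$ on $\ell^2(G)$. A unitary representation $\pi_1$ is weakly contained in $\pi_2$ if for all $\varepsilon>0$, all vectors $\xi$ of $\pi_1$ and all finite $K\subset G$ there are finitely many vectors $\nu_1,\dots,\nu_n$ of $\pi_2$ with $|\langle\pi_1(g)\xi\,|\,\xi\rangle-\sum_i\langle\pi_2(g)\nu_i\,|\,\nu_i\rangle|<\varepsilon$ for all $g\in K$; two representations are weakly equivalent if each is weakly contained in the other. For a vertex $v$ let $\mathrm{St}_G(vT)$ be the subgroup of the elements of $G$ that fix $v$ and all its descendants. Then: 1. $H\cong(\mathbb Z/2)^2\rtimes\mathbb Z/3$ with a non-trivial action of $\mathbb Z/3$, and $(h,k)\mapsto\bar h\,\bar s^{\,k}$ is an isomorphism from $H\times\mathbb Z$ onto $G$. 2. $G$ acts transitively on every level of $T$. 3. For every vertex $v$ other than the root, $\mathrm{St}_G(vT)$ is non-trivial, finite and not central in $G$, and its normalizer has finite index in $G$. 4. $\rho$ is weakly equivalent to $\lambda$. 5. The linear extension $\rho\colon\mathbb C[G]\to\mathcal B(\ell^2(T^0))$ is injective. 6. Consequently, the hypothesis on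 normalizers cannot be dropped from the following theorem, neither for the first nor for the second form of its conclusion: if $\Gamma$ is a countable group in which the normalizer of every finite non-central subgroup has infinite index, and $\Gamma$ acts spherically transitively on a rooted tree $T_{d_0,d_1,\dots}$ (all $d_i\ge 2$) with some non-trivial subtree stabilizer, then the tree representation is not faithful on $\mathbb C[\Gamma]$, and hence does not weakly contain the regular representation. That is, each of the two implications obtained by omitting this hypothesis is false, already for subgroups $\Gamma\le\mathrm{Aut}(T_{d_0,d_1,\dots})$. -/

import Mathlib

noncomputable section

namespace TreeRep

/-! ### Rooted trees -/

/-- The shifted sequence `d₁, d₂, …`. -/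
def shift (d : ℕ → ℕ) : ℕ → ℕ := fun n => d (n + 1)

/-- Vertices of the rooted tree `T_d`, labelled by the finite words `i₁ i₂ … iₙ` with
`i_{k+1} ∈ Fin (d k)`: a word is either empty (the root) or a first letter followed by a
vertex of the tree `T_{shift d}`. -/
inductive Vertex : (ℕ → ℕ) → Type
  | root {d : ℕ → ℕ} : Vertex d
  | cons {d : ℕ → ℕ} (i : Fin (d 0)) (w : Vertex (shift d)) : Vertex d

namespace Vertex

/-- The level of a vertex: the number of letters of the word (it is the graph distance to the
root, see `dist_root`). -/
def level : ∀ {d : ℕ → ℕ}, Vertex d → ℕ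
  | _, root => 0
  | _, cons _ w => level w + 1

/-- `IsChild v w`: the word `w` is the word `v` followed by exactly one more letter. -/
inductive IsChild : ∀ {d : ℕ → ℕ}, Vertex d → Vertex d → Prop
  | root {d : ℕ → ℕ} (i : Fin (d 0)) : IsChild (root : Vertex d) (cons i root)
  | cons {d : ℕ → ℕ} (i : Fin (d 0)) {v w : Vertex (shift d)} (h : IsChild v w) :
      IsChild (cons i v) (cons i w)

theorem IsChild.level_eq {d : ℕ → ℕ} {v w : Vertex d} (h : IsChild v w) :
    level w = level v + 1 := by
  induction h with
  | root i => rfl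
  | cons i h ih => simp only [level, ih]

/-- `w` is a descendant of `v` (possibly `v` itself): the word `w` extends the word `v`. -/
def IsDescendant {d : ℕ → ℕ} (v w : Vertex d) : Prop := Relation.ReflTransGen IsChild v w

end Vertex

open Vertex

/-- The rooted tree `T_d`, as a simple graph: two words are joined by an edge when one of them is
the other one followed by one more letter. -/
def tree (d : ℕ → ℕ) : SimpleGraph (Vertex d) where
  Adj v w := IsChild v w ∨ IsChild w v
  symm := ⟨fun _ _ h => h.symm⟩
  loopless := ⟨fun v h => by
    rcases h with h | h <;> have := h.level_eq <;> omega⟩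

theorem tree_adj {d : ℕ → ℕ} {v w : Vertex d} :
    (tree d).Adj v w ↔ IsChild v w ∨ IsChild w v := Iff.rfl

theorem exists_walk_root : ∀ {d : ℕ → ℕ} (v : Vertex d),
    ∃ p : (tree d).Walk root v, p.length = level v := by
  have key : ∀ {d : ℕ → ℕ} (i : Fin (d 0)) {v w : Vertex (shift d)} (p : (tree (shift d)).Walk v w),
      ∃ q : (tree d).Walk (cons i v) (cons i w), q.length = p.length := by
    intro d i v w p
    induction p with
    | nil => exact ⟨.nil, rfl⟩
    | cons h p ih =>
      obtain ⟨q, hq⟩ := ih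
      have h' : (tree d).Adj _ _ := Or.imp (IsChild.cons i) (IsChild.cons i) h
      exact ⟨.cons h' q, by rw [SimpleGraph.Walk.length_cons, SimpleGraph.Walk.length_cons, hq]⟩
  intro d v
  induction v with
  | root => exact ⟨.nil, rfl⟩
  | @cons d i w ih =>
    obtain ⟨p, hp⟩ := ih
    obtain ⟨q, hq⟩ := key i p
    have h : (tree d).Adj root (cons i root) := Or.inl (IsChild.root i)
    exact ⟨.cons h q, by rw [SimpleGraph.Walk.length_cons, hq, hp, level]⟩

/-- The level of a vertex is its distance to the root in the graph `T_d`. -/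
theorem dist_root {d : ℕ → ℕ} (v : Vertex d) : (tree d).dist root v = level v := by
  obtain ⟨p, hp⟩ := exists_walk_root v
  refine le_antisymm (hp ▸ SimpleGraph.dist_le p) ?_
  have key : ∀ {u w : Vertex d} (q : (tree d).Walk u w), level w ≤ level u + q.length := by
    intro u w q
    induction q with
    | nil => simp
    | cons h q ih =>
      rw [SimpleGraph.Walk.length_cons]
      rcases id h with h | h <;> have := h.level_eq <;> omega
  obtain ⟨q, hq⟩ := p.reachable.exists_walk_length_eq_dist
  have := key q
  rw [hq] at this
  simpa [level] using this

/-- `Aut(T_d)`: the group of automorphisms of the graph `T_d` which fix the root. -/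
def treeAut (d : ℕ → ℕ) : Subgroup (tree d ≃g tree d) where
  carrier := {g | g root = root}
  one_mem' := rfl
  mul_mem' {a b} ha hb := by
    change a (b root) = root
    rw [show b root = root from hb, show a root = root from ha]
  inv_mem' {a} ha := by
    change a.symm root = root
    rw [RelIso.symm_apply_eq]
    exact (show a root = root from ha).symm

theorem treeAut_root {d : ℕ → ℕ} (g : treeAut d) : (g : tree d ≃g tree d) root = root := g.2

/-! ### The recursion isomorphism (its inverse) -/

/-- The permutation `i w ↦ π(i) φ_{π(i)}(w)` of the vertices of `T_d`, which fixes the root. -/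
def recEquiv {d : ℕ → ℕ} (φ : Fin (d 0) → treeAut (shift d)) (π : Equiv.Perm (Fin (d 0))) :
    Equiv.Perm (Vertex d) where
  toFun
    | root => root
    | cons i w => cons (π i) ((φ (π i) : tree (shift d) ≃g tree (shift d)) w)
  invFun
    | root => root
    | cons j w => cons (π.symm j) ((φ j : tree (shift d) ≃g tree (shift d)).symm w)
  left_inv v := by cases v <;> simp
  right_inv v := by cases v <;> simp

theorem adj_cons_cons {d : ℕ → ℕ} {i j : Fin (d 0)} {v w : Vertex (shift d)} :
    (tree d).Adj (cons i v) (cons j w) ↔ i = j ∧ (tree (shift d)).Adj v w := by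
  constructor
  · rintro (h | h) <;> cases h
    · exact ⟨rfl, Or.inl ‹_›⟩
    · exact ⟨rfl, Or.inr ‹_›⟩
  · rintro ⟨rfl, h⟩
    exact h.imp (IsChild.cons i) (IsChild.cons i)

theorem adj_root_cons {d : ℕ → ℕ} {i : Fin (d 0)} {v : Vertex (shift d)} :
    (tree d).Adj root (cons i v) ↔ v = root := by
  constructor
  · rintro (h | h) <;> cases h
    rfl
  · rintro rfl
    exact Or.inl (IsChild.root i)

/-- The automorphism `g` of `T_d` whose image under the recursion isomorphism
`Aut(T_d) ≃ (∏_{i} Aut(T_{shift d})) ⋊ Perm(L₁)` is `(φ_i)_i . π`: it permutes the first level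
by `π`, and carries the subtree at `i` to the subtree at `π(i)` by `φ_{π(i)}`. -/
def ofRec {d : ℕ → ℕ} (φ : Fin (d 0) → treeAut (shift d)) (π : Equiv.Perm (Fin (d 0))) :
    treeAut d :=
  ⟨{ recEquiv φ π with
     map_rel_iff' := by
      have hr : ∀ (g : treeAut (shift d)) (w : Vertex (shift d)),
          (g : tree (shift d) ≃g tree (shift d)) w = root ↔ w = root := fun g w => by
        rw [← (g : tree (shift d) ≃g tree (shift d)).injective.eq_iff (a := w) (b := root),
          treeAut_root g]
      intro a b
      change (tree d).Adj (recEquiv φ π a) (recEquiv φ π b) ↔ _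
      cases a with
      | root => cases b with
        | root => exact Iff.rfl
        | cons j w => exact adj_root_cons.trans ((hr _ _).trans adj_root_cons.symm)
      | cons i v => cases b with
        | root =>
          rw [SimpleGraph.adj_comm, SimpleGraph.adj_comm (tree d) (cons i v)]
          exact adj_root_cons.trans ((hr _ _).trans adj_root_cons.symm)
        | cons j w =>
          change (tree d).Adj (cons (π i) _) (cons (π j) _) ↔ _
          rw [adj_cons_cons, adj_cons_cons, π.injective.eq_iff]
          refine and_congr_right ?_
          rintro rfl
          exact (φ (π i) : tree (shift d) ≃g tree (shift d)).map_rel_iff }, rfl⟩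

/-! ### The adding machine -/

/-- The adding machine on words: add one to the first letter, with carry to the right. -/
def addOne : ∀ {d : ℕ → ℕ}, Vertex d → Vertex d
  | _, root => root
  | d, cons i w => cons (finRotate (d 0) i) (if (i : ℕ) + 1 = d 0 then addOne w else w)

/-- The inverse of the adding machine. -/
def subOne : ∀ {d : ℕ → ℕ}, Vertex d → Vertex d
  | _, root => root
  | d, cons j w => cons ((finRotate (d 0)).symm j) (if (j : ℕ) = 0 then subOne w else w)

theorem finRotate_val {n : ℕ} (i : Fin n) :
    ((finRotate n i : Fin n) : ℕ) = if (i : ℕ) + 1 = n then 0 else (i : ℕ) + 1 := by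
  cases n with
  | zero => exact i.elim0
  | succ n =>
    rw [coe_finRotate]
    simp [Fin.ext_iff]

theorem finRotate_val_eq_zero {n : ℕ} (i : Fin n) :
    ((finRotate n i : Fin n) : ℕ) = 0 ↔ (i : ℕ) + 1 = n := by
  rw [finRotate_val]; split_ifs <;> simp_all

theorem subOne_addOne : ∀ {d : ℕ → ℕ} (v : Vertex d), subOne (addOne v) = v := by
  intro d v
  induction v with
  | root => rfl
  | cons i w ih =>
    simp only [addOne, subOne, finRotate_val_eq_zero, Equiv.symm_apply_apply]
    split_ifs <;> simp [ih]

theorem addOne_subOne : ∀ {d : ℕ → ℕ} (v : Vertex d), addOne (subOne v) = v := by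
  intro d v
  induction v with
  | root => rfl
  | cons i w ih =>
    simp only [addOne, subOne, ← finRotate_val_eq_zero, Equiv.apply_symm_apply]
    split_ifs <;> simp [ih]

theorem isChild_addOne {d : ℕ → ℕ} {v w : Vertex d} (h : IsChild v w) :
    IsChild (addOne v) (addOne w) := by
  induction h with
  | root i =>
    simp only [addOne, ite_self]
    exact IsChild.root _
  | cons i h ih =>
    simp only [addOne]
    split_ifs
    exacts [IsChild.cons _ ih, IsChild.cons _ h]

theorem isChild_subOne {d : ℕ → ℕ} {v w : Vertex d} (h : IsChild v w) :
    IsChild (subOne v) (subOne w) := by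
  induction h with
  | root i =>
    simp only [subOne, ite_self]
    exact IsChild.root _
  | cons i h ih =>
    simp only [subOne]
    split_ifs
    exacts [IsChild.cons _ ih, IsChild.cons _ h]

/-- The adding machine, as an automorphism of `T_d`. -/
def odometer (d : ℕ → ℕ) : treeAut d :=
  ⟨{ toFun := addOne
     invFun := subOne
     left_inv := subOne_addOne
     right_inv := addOne_subOne
     map_rel_iff' := by
      intro a b
      constructor
      · intro h
        have := Or.imp isChild_subOne isChild_subOne h
        rwa [Equiv.coe_fn_mk, subOne_addOne, subOne_addOne] at this
      · exact Or.imp isChild_addOne isChild_addOne }, rfl⟩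

/-- The integer `i₁ + d₀ i₂ + d₀ d₁ i₃ + ⋯` represented by a word. Sending a vertex `v` of
level `n` to the coset of `value v` modulo `d₀ d₁ ⋯ d_{n-1}` identifies `T_d` with the tree of
cosets of the subgroups `d₀ ⋯ d_{n-1} ℤ` of `ℤ`. -/
def value : ∀ {d : ℕ → ℕ}, Vertex d → ℕ
  | _, root => 0
  | d, cons i w => i + d 0 * value w

/-- The edges of `T_d` correspond to the inclusions of cosets. -/
theorem value_child {d : ℕ → ℕ} {v w : Vertex d} (h : IsChild v w) :
    value w ≡ value v [MOD ∏ k ∈ Finset.range (level v), d k] := by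
  induction h with
  | root i => simp [level, Nat.modEq_one]
  | @cons d i v w h ih =>
    simp only [level, value, Finset.prod_range_succ', mul_comm _ (d 0)]
    exact (Nat.ModEq.mul_left' (d 0) ih).add_left _

/-- In terms of cosets, the adding machine is the translation by `1`. -/
theorem value_odometer {d : ℕ → ℕ} (v : Vertex d) :
    value ((odometer d : tree d ≃g tree d) v) ≡ value v + 1
      [MOD ∏ k ∈ Finset.range (level v), d k] := by
  change value (addOne v) ≡ _ [MOD _]
  induction v with
  | root => simp [level, Nat.modEq_one]
  | @cons d i w ih =>
    simp only [level, addOne, value, finRotate_val, Finset.prod_range_succ', mul_comm _ (d 0)]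
    split_ifs with h
    · have := Nat.ModEq.mul_left' (d 0) ih
      rw [mul_add, mul_one] at this
      rw [zero_add, show (i : ℕ) + d 0 * value w + 1 = d 0 * value w + d 0 by omega]
      exact this
    · rw [add_right_comm]

/-! ### Groups acting on rooted trees -/

/-- The action on `T_d` of a group of automorphisms is transitive on each level. -/
def SphericallyTransitive {d : ℕ → ℕ} (G : Subgroup (treeAut d)) : Prop :=
  ∀ v w : Vertex d, level v = level w → ∃ g : G, g • v = w

/-- The stabilizer `St_G(vT)`: the elements of `G` which fix every descendant of `v`. -/
def subtreeStabilizer {d : ℕ → ℕ} (G : Subgroup (treeAut d)) (v : Vertex d) : Subgroup G :=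
  fixingSubgroup G {w : Vertex d | IsDescendant v w}

/-! ### Unitary representations -/

/-- The Hilbert space `ℓ²(X)`. -/
abbrev L2 (X : Type*) : Type _ := lp (fun _ : X => ℂ) 2

/-- The unitary operator `ξ ↦ ξ ∘ e⁻¹` of `ℓ²(X)`. -/
def permUnitary {X : Type*} (e : Equiv.Perm X) : L2 X ≃ₗᵢ[ℂ] L2 X :=
  have hmem : ∀ (f : Equiv.Perm X) (ξ : L2 X), Memℓp (fun x => (ξ : X → ℂ) (f x)) 2 := by
    intro f ξ
    have h := lp.memℓp ξ
    rw [memℓp_gen_iff (by simp)] at h ⊢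
    exact (f.summable_iff (f := fun x => ‖(ξ : X → ℂ) x‖ ^ (2 : ENNReal).toReal)).2 h
  { toFun := fun ξ => ⟨fun x => (ξ : X → ℂ) (e.symm x), hmem e.symm ξ⟩
    invFun := fun ξ => ⟨fun x => (ξ : X → ℂ) (e x), hmem e ξ⟩
    map_add' := fun _ _ => rfl
    map_smul' := fun _ _ => rfl
    left_inv := fun ξ => by ext x; simp
    right_inv := fun ξ => by ext x; simp
    norm_map' := fun ξ => by
      rw [lp.norm_eq_tsum_rpow (by simp), lp.norm_eq_tsum_rpow (by simp)]
      congr 1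
      exact e.symm.tsum_eq (fun x => ‖(ξ : X → ℂ) x‖ ^ (2 : ENNReal).toReal) }

/-- The permutation representation of `G` on `ℓ²(X)`: `(ρ(g) ξ)(x) = ξ(g⁻¹ x)`. -/
def permRep (G X : Type*) [Group G] [MulAction G X] : G →* (L2 X ≃ₗᵢ[ℂ] L2 X) where
  toFun g := permUnitary (MulAction.toPerm g)
  map_one' := by ext ξ x; simp [permUnitary]
  map_mul' g h := by ext ξ x; simp [permUnitary, mul_smul]

theorem permRep_apply {G X : Type*} [Group G] [MulAction G X] (g : G) (ξ : L2 X) (x : X) :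
    (permRep G X g ξ : X → ℂ) x = (ξ : X → ℂ) (g⁻¹ • x) := rfl

/-- The regular representation `λ` of `G` on `ℓ²(G)`: `(λ(g) ξ)(h) = ξ(g⁻¹ h)`. -/
def regularRep (G : Type*) [Group G] : G →* (L2 G ≃ₗᵢ[ℂ] L2 G) := permRep G G

/-- `π₁ ≺ π₂`: the unitary representation `π₁` is weakly contained in `π₂`. -/
def WeaklyContained {G H₁ H₂ : Type*} [Group G]
    [NormedAddCommGroup H₁] [InnerProductSpace ℂ H₁] [NormedAddCommGroup H₂]
    [InnerProductSpace ℂ H₂] (π₁ : G →* (H₁ ≃ₗᵢ[ℂ] H₁)) (π₂ : G →* (H₂ ≃ₗᵢ[ℂ] H₂)) : Prop :=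
  ∀ ε : ℝ, 0 < ε → ∀ (ξ : H₁) (K : Finset G), ∃ (n : ℕ) (ν : Fin n → H₂),
    ∀ g ∈ K, ‖inner ℂ ξ (π₁ g ξ) - ∑ i, inner ℂ (ν i) (π₂ g (ν i))‖ < ε

/-- Weak equivalence (weak isomorphism) of unitary representations. -/
def WeaklyEquivalent {G H₁ H₂ : Type*} [Group G]
    [NormedAddCommGroup H₁] [InnerProductSpace ℂ H₁] [NormedAddCommGroup H₂]
    [InnerProductSpace ℂ H₂] (π₁ : G →* (H₁ ≃ₗᵢ[ℂ] H₁)) (π₂ : G →* (H₂ ≃ₗᵢ[ℂ] H₂)) : Prop :=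
  WeaklyContained π₁ π₂ ∧ WeaklyContained π₂ π₁

/-- The linear extension `∑ a_g g ↦ ∑ a_g π(g)` of a unitary representation to the group algebra
`ℂ[G]`, with values in the bounded operators. -/
def groupAlgebraRep {G H : Type*} [Group G] [NormedAddCommGroup H] [InnerProductSpace ℂ H]
    (π : G →* (H ≃ₗᵢ[ℂ] H)) : MonoidAlgebra ℂ G →ₐ[ℂ] (H →L[ℂ] H) :=
  MonoidAlgebra.lift ℂ (H →L[ℂ] H) G
    { toFun := fun g => ((π g).toContinuousLinearEquiv : H →L[ℂ] H)
      map_one' := by ext; simp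
      map_mul' := fun g h => by ext; simp }

/-! ### The example -/

/-- The sequence `6, 2, 2, 2, …`. -/
def sixTwo : ℕ → ℕ
  | 0 => 6
  | _ + 1 => 2

theorem shift_sixTwo : shift sixTwo = fun _ => 2 := rfl

/-- `α = (1,3,5)(2,4,6)`, where `Fin 6 = {0, …, 5}` stands for `{1, …, 6}`. -/
def permAlpha : Equiv.Perm (Fin 6) := List.formPerm [0, 2, 4] * List.formPerm [1, 3, 5]

/-- `β_r = (1,2)(3,4)`. -/
def permBeta : Equiv.Perm (Fin 6) := Equiv.swap 0 1 * Equiv.swap 2 3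

/-- The group `H` of permutations of the first level, generated by `α` and `β_r`. -/
def groupH : Subgroup (Equiv.Perm (Fin 6)) := Subgroup.closure {permAlpha, permBeta}

/-- The automorphism `(1,1,1,1,1,1).π` of `T_{6,2,2,…}`. -/
def liftPerm (π : Equiv.Perm (Fin 6)) : treeAut sixTwo := ofRec (fun _ => 1) π

/-- The automorphism `(s,s,s,s,s,s)` of `T_{6,2,2,…}`, where `s` is the adding machine on
`T_{2,2,…}`. -/
def sBar : treeAut sixTwo := ofRec (fun _ => odometer (shift sixTwo)) 1

/-- The group `G` generated by the lifts of `α`, `β_r` and by `(s,s,s,s,s,s)`. -/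
def groupG : Subgroup (treeAut sixTwo) :=
  Subgroup.closure {liftPerm permAlpha, liftPerm permBeta, sBar}

/-- The tree representation of `G` on `ℓ²` of the vertex set of `T_{6,2,2,…}`. -/
def treeRep : groupG →* (L2 (Vertex sixTwo) ≃ₗᵢ[ℂ] L2 (Vertex sixTwo)) :=
  permRep groupG (Vertex sixTwo)

end TreeRep

end

namespace TreeRep

open Vertex

/-! ### The group `H` -/

/-! The group `G` is `H × ℤ` with `H` a copy of the alternating group `A₄` acting transitively on
six points. An element `(h, k)` sends `i w` to `h(i) sᵏ(w)`, and `sᵏ` with `k ≠ 0` moves every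
sufficiently deep vertex. So a stabilizer of a proper subtree is a point stabilizer in `H`: finite
and non-central, while the central factor `ℤ` has finite index and lies in its normalizer
(`subtreeStabilizer_groupG`).

Nevertheless no representation is lost, because `ℂ⁶` contains every irreducible representation of
`A₄`: the three characters and the three-dimensional one, each once. Hence the canonical trace of
`H` is a positive combination of diagonal coefficients on `ℂ⁶` (`groupH_trace`). Placing the same
vectors at `i w` for one deep `w` kills all elements of a given finite set with `k ≠ 0`, so on
finite sets the canonical trace of `G` is a sum of coefficients of `ρ` (`reproducesTrace_treeRep`).

This property alone yields faithfulness on `ℂ[G]` and the weak containment of `λ` in `ρ`. The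
reverse containment is Hulanicki's theorem, `G` being amenable with Følner sets `H × [0, N)`. -/

/-- The action of `ℤ/3` on `(ℤ/2)²` by the powers of a matrix of order three. -/
def cyc (c : ZMod 3) (x : ZMod 2 × ZMod 2) : ZMod 2 × ZMod 2 :=
  if c = 0 then x else if c = 1 then (x.2, x.1 + x.2) else (x.1 + x.2, x.1)

theorem cyc_zero (x : ZMod 2 × ZMod 2) : cyc 0 x = x := rfl

theorem cyc_add : ∀ (c c' : ZMod 3) (x : ZMod 2 × ZMod 2), cyc (c + c') x = cyc c (cyc c' x) := by
  decide

theorem cyc_map_add : ∀ (c : ZMod 3) (x y : ZMod 2 × ZMod 2), cyc c (x + y) = cyc c x + cyc c y := by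
  decide

/-- The action of `ℤ/3` on `(ℤ/2)²`, as a homomorphism to the automorphism group. -/
def cycHom : Multiplicative (ZMod 3) →* MulAut (Multiplicative (ZMod 2 × ZMod 2)) where
  toFun c :=
    { toFun := fun x => .ofAdd (cyc c.toAdd x.toAdd)
      invFun := fun x => .ofAdd (cyc (-c.toAdd) x.toAdd)
      left_inv := fun x => by
        simp only [toAdd_ofAdd, ← cyc_add, neg_add_cancel, cyc_zero, ofAdd_toAdd]
      right_inv := fun x => by
        simp only [toAdd_ofAdd, ← cyc_add, add_neg_cancel, cyc_zero, ofAdd_toAdd]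
      map_mul' := fun x y => by
        simp only [toAdd_mul, cyc_map_add, ofAdd_add] }
  map_one' := by ext x : 1; rfl
  map_mul' c c' := by
    ext x : 1
    exact congrArg Multiplicative.ofAdd (cyc_add c.toAdd c'.toAdd x.toAdd)

/-- The elements of `H` in normal form. -/
def normalForm (x : ZMod 2 × ZMod 2) (c : ZMod 3) : Equiv.Perm (Fin 6) :=
  permBeta ^ x.1.val * (permAlpha * permBeta * permAlpha⁻¹) ^ x.2.val * permAlpha ^ c.val

/-- Conjugation by `permAlpha` permutes the three involutions of the Klein four-group cyclically,
and `cyc 1` is this 3-cycle in the basis formed by `permBeta` and its conjugate. All statements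
about `H` thereby reduce to checks on twelve explicit elements. -/
theorem normalForm_mul : ∀ (x y : ZMod 2 × ZMod 2) (c c' : ZMod 3),
    normalForm x c * normalForm y c' = normalForm (x + cyc c y) (c + c') := by
  decide +kernel

theorem normalForm_eq_one : ∀ (x : ZMod 2 × ZMod 2) (c : ZMod 3),
    normalForm x c = 1 → x = 0 ∧ c = 0 := by
  decide +kernel

theorem normalForm_alpha : normalForm 0 1 = permAlpha := by decide +kernel

theorem normalForm_beta : normalForm (1, 0) 0 = permBeta := by decide +kernel

/-- The parametrization of `H` by the semidirect product. -/
def semidirectHom :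
    Multiplicative (ZMod 2 × ZMod 2) ⋊[cycHom] Multiplicative (ZMod 3) →* Equiv.Perm (Fin 6) where
  toFun x := normalForm x.left.toAdd x.right.toAdd
  map_one' := by
    change normalForm 0 0 = 1
    decide +kernel
  map_mul' x y := (normalForm_mul _ _ _ _).symm

theorem semidirectHom_injective : Function.Injective semidirectHom := by
  rw [injective_iff_map_eq_one]
  rintro ⟨x, c⟩ h
  obtain ⟨h₁, h₂⟩ := normalForm_eq_one x.toAdd c.toAdd h
  ext1
  exacts [h₁, h₂]

theorem range_semidirectHom : semidirectHom.range = groupH := by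
  apply le_antisymm
  · rintro _ ⟨x, rfl⟩
    have hα : permAlpha ∈ groupH := Subgroup.subset_closure (by simp)
    have hβ : permBeta ∈ groupH := Subgroup.subset_closure (by simp)
    exact mul_mem (mul_mem (pow_mem hβ _)
      (pow_mem (mul_mem (mul_mem hα hβ) (inv_mem hα)) _)) (pow_mem hα _)
  · refine (Subgroup.closure_le _).2 ?_
    rintro _ (rfl | rfl)
    · exact ⟨⟨1, .ofAdd 1⟩, normalForm_alpha⟩
    · exact ⟨⟨.ofAdd (1, 0), 1⟩, normalForm_beta⟩

theorem normalForm_mem (x : ZMod 2 × ZMod 2) (c : ZMod 3) : normalForm x c ∈ groupH :=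
  range_semidirectHom ▸ ⟨⟨.ofAdd x, .ofAdd c⟩, rfl⟩

theorem mem_groupH {π : Equiv.Perm (Fin 6)} : π ∈ groupH ↔ ∃ x c, normalForm x c = π := by
  constructor
  · intro h
    rw [← range_semidirectHom] at h
    obtain ⟨y, rfl⟩ := h
    exact ⟨y.left.toAdd, y.right.toAdd, rfl⟩
  · rintro ⟨x, c, rfl⟩
    exact normalForm_mem x c

theorem groupH_semidirect : ∃ φ : Multiplicative (ZMod 3) →*
    MulAut (Multiplicative (ZMod 2 × ZMod 2)), φ ≠ 1 ∧
      Nonempty (groupH ≃* Multiplicative (ZMod 2 × ZMod 2) ⋊[φ] Multiplicative (ZMod 3)) := by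
  refine ⟨cycHom, fun h => ?_, ⟨((MonoidHom.ofInjective semidirectHom_injective).trans
    (MulEquiv.subgroupCongr range_semidirectHom)).symm⟩⟩
  have := DFunLike.congr_fun (DFunLike.congr_fun h (.ofAdd 1)) (.ofAdd (1, 0))
  have h' : cyc 1 (1, 0) = (1, 0) := this
  exact absurd h' (by decide)

theorem groupH_transitive (i j : Fin 6) : ∃ π ∈ groupH, π i = j := by
  have : ∀ i j : Fin 6, ∃ x c, normalForm x c i = j := by decide +kernel
  obtain ⟨x, c, h⟩ := this i j
  exact ⟨_, normalForm_mem x c, h⟩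

/-- Point stabilizers have order 12/6 = 2, and `A₄` has trivial centre. This is the source of
non-central elements in the subtree stabilizers. -/
theorem groupH_stabilizer (i : Fin 6) :
    ∃ π ∈ groupH, ∃ τ ∈ groupH, π i = i ∧ π * τ ≠ τ * π := by
  have : ∀ i : Fin 6, ∃ x c y c', normalForm x c i = i ∧
      normalForm x c * normalForm y c' ≠ normalForm y c' * normalForm x c := by decide +kernel
  obtain ⟨x, c, y, c', h⟩ := this i
  exact ⟨_, normalForm_mem x c, _, normalForm_mem y c', h⟩

/-- The first element of a block of imprimitivity of `H`. -/
def blockFst (p : Fin 3) : Fin 6 := ⟨2 * p, by omega⟩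

/-- The second element of a block of imprimitivity of `H`. -/
def blockSnd (p : Fin 3) : Fin 6 := ⟨2 * p + 1, by omega⟩

/-- A combination of matrix coefficients of the permutation representation of `H` on `ℂ⁶`
vanishes outside of the identity. -/
theorem groupH_trace {π : Equiv.Perm (Fin 6)} (hπ : π ∈ groupH) :
    ((∑ a, if a = π a then 1 else 0) + ∑ p,
      ((if blockFst p = π (blockFst p) then 1 else 0)
        + (if blockSnd p = π (blockSnd p) then 1 else 0)
        - (if blockFst p = π (blockSnd p) then 1 else 0)
        - (if blockSnd p = π (blockFst p) then 1 else 0)) : ℤ) = if π = 1 then 12 else 0 := by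
  -- Conceptually, the first sum is the character of `ℂ⁶`. The differences of the two basis vectors
  -- in each block span the three-dimensional irreducible subspace and have squared norm 2, so the
  -- second sum is twice its character. Together every irreducible character occurs with its degree
  -- as multiplicity, which is the regular character.
  obtain ⟨x, c, rfl⟩ := mem_groupH.1 hπ
  clear hπ
  revert x c
  decide +kernel

theorem treeAut_ext {d : ℕ → ℕ} {g h : treeAut d} (H : ∀ v : Vertex d, g • v = h • v) : g = h :=
  Subtype.ext (RelIso.ext H)

/-! ### The group `G` -/

/-- The automorphisms which permute the first level by `π` and carry out the same automorphism in
each of the subtrees. -/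
def recHom (d : ℕ → ℕ) : Equiv.Perm (Fin (d 0)) × treeAut (shift d) →* treeAut d where
  toFun x := ofRec (fun _ => x.2) x.1
  map_one' := treeAut_ext fun v => by cases v <;> rfl
  map_mul' x y := treeAut_ext fun v => by cases v <;> rfl

/-! ### Powers of the adding machine as translations of cosets -/

theorem level_odometer {d : ℕ → ℕ} (v : Vertex d) : level (odometer d • v) = level v := by
  change level (addOne v) = _
  induction v with
  | root => rfl
  | cons i w ih =>
    simp only [addOne, level]
    split_ifs <;> simp [ih]

theorem level_odometer_zpow {d : ℕ → ℕ} (k : ℤ) (v : Vertex d) :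
    level (odometer d ^ k • v) = level v := by
  induction k generalizing v with
  | zero => simp
  | succ n ih => rw [zpow_add_one, mul_smul, ih, level_odometer]
  | pred n ih =>
    rw [zpow_sub_one, mul_smul, ih, ← level_odometer (_ • v), smul_inv_smul]

theorem value_odometer_zpow {d : ℕ → ℕ} (k : ℤ) (v : Vertex d) :
    (value (odometer d ^ k • v) : ℤ) ≡ value v + k [ZMOD ∏ j ∈ Finset.range (level v), d j] := by
  have step (v : Vertex d) : (value (odometer d • v) : ℤ) ≡ value v + 1
      [ZMOD ∏ j ∈ Finset.range (level v), d j] := by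
    exact_mod_cast Int.natCast_modEq_iff.2 (value_odometer v)
  induction k generalizing v with
  | zero => simp
  | succ n ih =>
    rw [zpow_add_one, mul_smul]
    have h := (ih (odometer d • v))
    rw [level_odometer] at h
    refine h.trans (((step v).add_right _).trans ?_)
    rw [add_assoc, add_comm (1 : ℤ)]
  | pred n ih =>
    rw [zpow_sub_one, mul_smul]
    have h := (ih ((odometer d)⁻¹ • v))
    have h2 := step ((odometer d)⁻¹ • v)
    have hl : level ((odometer d)⁻¹ • v) = level v := by
      simpa using level_odometer_zpow (-1) v
    rw [smul_inv_smul, hl] at h2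
    rw [hl] at h
    refine h.trans ?_
    have h3 := (h2.sub_right 1).symm.add_right (-(n : ℤ))
    rw [add_sub_cancel_right] at h3
    refine h3.trans ?_
    rw [show (value v : ℤ) - 1 + -(n : ℤ) = value v + (-(n : ℤ) - 1) by ring]

/-- Uniqueness of mixed-radix digits: reduction modulo `d 0` recovers the first letter, and
cancelling it and dividing by `d 0` leaves the same claim for the tails. -/
theorem value_injective : ∀ {d : ℕ → ℕ} {v w : Vertex d}, level v = level w →
    value v ≡ value w [MOD ∏ k ∈ Finset.range (level v), d k] → v = w := by
  intro d v
  induction v with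
  | root =>
    intro w hl _
    cases w with
    | root => rfl
    | cons j w => simp [level] at hl
  | @cons d i v ih =>
    intro w hl h
    cases w with
    | root => simp [level] at hl
    | cons j w =>
      simp only [level, add_left_inj] at hl
      simp only [level, value, Finset.prod_range_succ', mul_comm _ (d 0)] at h
      have hij : i = j := by
        have := h.of_mul_right _
        simp only [Nat.ModEq, Nat.add_mul_mod_self_left, Nat.mod_eq_of_lt i.isLt,
          Nat.mod_eq_of_lt j.isLt] at this
        exact Fin.ext this
      subst hij
      have h2 := Nat.ModEq.add_left_cancel' _ h
      have := i.pos
      rw [ih hl (Nat.ModEq.mul_left_cancel' (by omega) h2)]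

theorem odometer_transitive {d : ℕ → ℕ} {v w : Vertex d} (h : level v = level w) :
    ∃ k : ℤ, odometer d ^ k • v = w := by
  refine ⟨value w - value v, value_injective ((level_odometer_zpow _ _).trans h) ?_⟩
  have := value_odometer_zpow (value w - value v) v
  rw [add_sub_cancel] at this
  rw [level_odometer_zpow]
  exact Int.natCast_modEq_iff.1 (by exact_mod_cast this)

/-- On level `n` the adding machine is translation by 1 on `ℤ/2ⁿ`, so its `k`-th power can fix a
vertex there only if `2ⁿ` divides `k`. -/
theorem odometer_zpow_smul_ne {w : Vertex (shift sixTwo)} {k : ℤ} (hk : k ≠ 0)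
    (hw : k.natAbs < 2 ^ level w) : odometer (shift sixTwo) ^ k • w ≠ w := by
  intro h
  have h2 := value_odometer_zpow k w
  rw [h] at h2
  have h3 : ((2 ^ level w : ℕ) : ℤ) ∣ k := by
    have := h2.symm.dvd
    simpa [shift_sixTwo] using this
  have := Nat.le_of_dvd (by omega) (Int.natCast_dvd.1 h3)
  omega

/-- A vertex below `v` at prescribed depth. -/
theorem exists_descendant : ∀ {d : ℕ → ℕ} (_ : ∀ n, 0 < d n) (v : Vertex d) (n : ℕ),
    ∃ w, IsDescendant v w ∧ n ≤ level w := by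
  have child : ∀ {d : ℕ → ℕ} (v : Vertex d) (_ : ∀ n, 0 < d n), ∃ w, IsChild v w := by
    intro d v
    induction v with
    | root => exact fun hd => ⟨_, IsChild.root ⟨0, hd 0⟩⟩
    | cons i v ih =>
      intro hd
      obtain ⟨w, hw⟩ := ih fun n => hd (n + 1)
      exact ⟨_, IsChild.cons i hw⟩
  intro d hd v n
  induction n with
  | zero => exact ⟨v, Relation.ReflTransGen.refl, Nat.zero_le _⟩
  | succ n ih =>
    obtain ⟨w, hw, hn⟩ := ih
    obtain ⟨u, hu⟩ := child w hd
    exact ⟨u, hw.tail hu, by rw [hu.level_eq]; omega⟩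

theorem isDescendant_cons_iff {d : ℕ → ℕ} {i : Fin (d 0)} {w : Vertex (shift d)} {u : Vertex d} :
    IsDescendant (cons i w) u ↔ ∃ w', IsDescendant w w' ∧ u = cons i w' := by
  constructor
  · intro h
    induction h with
    | refl => exact ⟨w, Relation.ReflTransGen.refl, rfl⟩
    | tail _ h ih =>
      obtain ⟨w', hw, rfl⟩ := ih
      cases h with
      | cons _ h => exact ⟨_, hw.tail h, rfl⟩
  · rintro ⟨w', h, rfl⟩
    exact h.lift (cons i) fun _ _ => IsChild.cons i

/-- The parametrization of `G` by `H × ℤ`. -/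
def paramHom : groupH × Multiplicative ℤ →* treeAut sixTwo :=
  (recHom sixTwo).comp (groupH.subtype.prodMap (zpowersHom _ (odometer (shift sixTwo))))

theorem paramHom_smul_cons (x : groupH × Multiplicative ℤ) (i : Fin 6)
    (w : Vertex (shift sixTwo)) :
    paramHom x • (cons i w : Vertex sixTwo) =
      cons ((x.1 : Equiv.Perm (Fin 6)) i) (odometer (shift sixTwo) ^ x.2.toAdd • w) := rfl

theorem paramHom_left (h : groupH) : paramHom (h, 1) = liftPerm h := rfl

theorem paramHom_right (k : ℤ) : paramHom (1, .ofAdd k) = sBar ^ k := by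
  have h1 : paramHom (1, .ofAdd 1) = sBar := by
    refine treeAut_ext fun v => ?_
    cases v with
    | root => rfl
    | cons i w =>
      refine (paramHom_smul_cons _ i w).trans ?_
      rw [toAdd_ofAdd, zpow_one]
      rfl
  rw [← h1, ← map_zpow]
  congr 1
  ext1
  · simp
  · simp [← ofAdd_zsmul]

theorem cons_injective {d : ℕ → ℕ} {i j : Fin (d 0)} {v w : Vertex (shift d)} :
    (cons i v : Vertex d) = cons j w ↔ i = j ∧ v = w := by
  constructor
  · rintro ⟨⟩
    exact ⟨rfl, rfl⟩
  · rintro ⟨rfl, rfl⟩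
    rfl

theorem sixTwo_shift_pos (n : ℕ) : 0 < shift sixTwo n := Nat.two_pos

theorem eq_zero_of_forall_descendant {w : Vertex (shift sixTwo)} {k : ℤ}
    (h : ∀ u, IsDescendant w u → odometer (shift sixTwo) ^ k • u = u) : k = 0 := by
  by_contra hk
  obtain ⟨u, hu, hl⟩ := exists_descendant sixTwo_shift_pos w k.natAbs
  exact odometer_zpow_smul_ne hk (Nat.lt_pow_self one_lt_two |>.trans_le
    (Nat.pow_le_pow_right two_pos hl)) (h u hu)

theorem paramHom_injective : Function.Injective paramHom := by
  rw [injective_iff_map_eq_one]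
  intro x hx
  have key (i : Fin 6) (w : Vertex (shift sixTwo)) :
      (x.1 : Equiv.Perm (Fin 6)) i = i ∧ odometer (shift sixTwo) ^ x.2.toAdd • w = w := by
    have := paramHom_smul_cons x i w
    rw [hx, one_smul] at this
    exact (cons_injective.1 this.symm)
  ext1
  · exact Subtype.ext (Equiv.ext fun i => (key i root).1)
  · exact eq_zero_of_forall_descendant (w := root) fun u _ => (key 0 u).2

theorem range_paramHom : paramHom.range = groupG := by
  apply le_antisymm
  · rintro _ ⟨⟨h, k⟩, rfl⟩
    have : ((h, k) : groupH × Multiplicative ℤ) = (h, 1) * (1, .ofAdd k.toAdd) := by simp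
    rw [this, map_mul, paramHom_left, paramHom_right]
    refine mul_mem ?_ (zpow_mem (Subgroup.subset_closure (by simp)) _)
    -- Lifting permutations is a homomorphism, so membership in `groupG` need only be checked on the
    -- two generators of `H`.
    let L : Equiv.Perm (Fin 6) →* treeAut sixTwo := (recHom sixTwo).comp (MonoidHom.inl _ _)
    change (h : Equiv.Perm (Fin 6)) ∈ groupG.comap L
    refine ((Subgroup.closure_le _).2 ?_ : groupH ≤ groupG.comap L) h.2
    rintro _ (rfl | rfl)
    · exact Subgroup.subset_closure (by left; rfl)
    · exact Subgroup.subset_closure (by right; left; rfl)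
  · refine (Subgroup.closure_le _).2 ?_
    rintro _ (rfl | rfl | rfl)
    · exact ⟨(⟨permAlpha, Subgroup.subset_closure (by simp)⟩, 1), rfl⟩
    · exact ⟨(⟨permBeta, Subgroup.subset_closure (by simp)⟩, 1), rfl⟩
    · exact ⟨(1, .ofAdd 1), by rw [paramHom_right, zpow_one]⟩

/-- The isomorphism of `H × ℤ` with `G`. -/
noncomputable def paramEquiv : groupH × Multiplicative ℤ ≃* groupG :=
  (MonoidHom.ofInjective paramHom_injective).trans (MulEquiv.subgroupCongr range_paramHom)

theorem paramEquiv_smul_cons (x : groupH × Multiplicative ℤ) (i : Fin 6)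
    (w : Vertex (shift sixTwo)) :
    paramEquiv x • (cons i w : Vertex sixTwo) =
      cons ((x.1 : Equiv.Perm (Fin 6)) i) (odometer (shift sixTwo) ^ x.2.toAdd • w) := rfl

theorem sphericallyTransitive_groupG : SphericallyTransitive groupG := by
  intro v w h
  cases v with
  | root => cases w with
    | root => exact ⟨1, one_smul _ _⟩
    | cons j w => simp [level] at h
  | cons i v => cases w with
    | root => simp [level] at h
    | cons j w =>
      obtain ⟨π, hπ, hij⟩ := groupH_transitive i j
      obtain ⟨k, hk⟩ := odometer_transitive (Nat.succ_injective h)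
      refine ⟨paramEquiv (⟨π, hπ⟩, .ofAdd k), ?_⟩
      exact (paramEquiv_smul_cons _ i v).trans (cons_injective.2 ⟨hij, hk⟩)

/-! ### Subtree stabilizers -/

/-- Only the trivial power of the adding machine fixes all descendants of `w`. The stabilizer is
therefore the stabilizer of `i` in `H`, whatever `w` is. -/
theorem paramEquiv_mem_subtreeStabilizer {x : groupH × Multiplicative ℤ} {i : Fin 6}
    {w : Vertex (shift sixTwo)} :
    paramEquiv x ∈ subtreeStabilizer groupG (cons i w : Vertex sixTwo) ↔
      (x.1 : Equiv.Perm (Fin 6)) i = i ∧ x.2 = 1 := by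
  rw [subtreeStabilizer, mem_fixingSubgroup_iff]
  constructor
  · intro h
    have key (u : Vertex (shift sixTwo)) (hu : IsDescendant w u) :=
      cons_injective.1 (h (cons i u) (isDescendant_cons_iff.2 ⟨u, hu, rfl⟩))
    exact ⟨(key w Relation.ReflTransGen.refl).1,
      eq_zero_of_forall_descendant fun u hu => (key u hu).2⟩
  · rintro ⟨h1, h2⟩ u hu
    obtain ⟨u, -, rfl⟩ := isDescendant_cons_iff.1 hu
    rw [paramEquiv_smul_cons, h1, h2]
    simp

theorem subtreeStabilizer_groupG {v : Vertex sixTwo} (hv : v ≠ root) :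
    subtreeStabilizer groupG v ≠ ⊥ ∧ Finite (subtreeStabilizer groupG v) ∧
      ¬ subtreeStabilizer groupG v ≤ Subgroup.center groupG ∧
      (Subgroup.normalizer (subtreeStabilizer groupG v : Set groupG)).FiniteIndex := by
  cases v with
  | root => exact absurd rfl hv
  | cons i w =>
    have hc : ¬ subtreeStabilizer groupG (cons i w : Vertex sixTwo) ≤ Subgroup.center groupG := by
      obtain ⟨π, hπ, τ, hτ, hi, hne⟩ := groupH_stabilizer i
      intro hle
      have h := hle ((paramEquiv_mem_subtreeStabilizer (x := (⟨π, hπ⟩, 1)) (w := w)).2 ⟨hi, rfl⟩)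
      have h2 := Subgroup.mem_center_iff.1 h (paramEquiv (⟨τ, hτ⟩, 1))
      rw [← map_mul, ← map_mul, paramEquiv.injective.eq_iff] at h2
      exact hne (congrArg (fun x => (x.1 : Equiv.Perm (Fin 6))) h2).symm
    refine ⟨fun h => hc (h ▸ bot_le), ?_, hc, ?_⟩
    · let f (g : subtreeStabilizer groupG (cons i w : Vertex sixTwo)) : groupH :=
        (paramEquiv.symm g).1
      refine Finite.of_injective f fun g g' h => ?_
      have key (g : subtreeStabilizer groupG (cons i w : Vertex sixTwo)) :
          (paramEquiv.symm g).2 = 1 :=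
        (paramEquiv_mem_subtreeStabilizer (x := paramEquiv.symm g) (w := w) (i := i)).1
          (by rw [MulEquiv.apply_symm_apply]; exact g.2) |>.2
      exact Subtype.ext (paramEquiv.symm.injective (Prod.ext h ((key g).trans (key g').symm)))
    · let q : groupG →* groupH := (MonoidHom.fst _ _).comp paramEquiv.symm.toMonoidHom
      -- The kernel of the projection to `H` is the factor `ℤ`: central, and of finite index because
      -- `H` is finite.
      have : q.ker ≤ Subgroup.center groupG := by
        intro g hg
        rw [Subgroup.mem_center_iff]
        intro g'
        apply paramEquiv.symm.injective
        have hg' : (paramEquiv.symm g).1 = 1 := hg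
        rw [map_mul, map_mul]
        ext1
        · simp [hg']
        · exact mul_comm _ _
      have hk : q.ker.FiniteIndex := inferInstance
      exact Subgroup.finiteIndex_of_le (this.trans (Subgroup.center_le_normalizer _))

open scoped ComplexConjugate

/-! ### Finitely supported vectors -/

theorem permRep_single {G X : Type*} [Group G] [MulAction G X] [DecidableEq X] (g : G) (x : X)
    (a : ℂ) : permRep G X g (lp.single 2 x a) = lp.single 2 (g • x) a := by
  ext y
  rw [permRep_apply]
  simp only [lp.coeFn_single, Pi.single_apply, inv_smul_eq_iff]

theorem inner_single_single {X : Type*} [DecidableEq X] (x y : X) (a b : ℂ) :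
    inner ℂ (lp.single 2 x a : L2 X) (lp.single 2 y b) = if x = y then conj a * b else 0 := by
  rw [lp.inner_single_left, lp.coeFn_single, Pi.single_apply]
  split_ifs with h
  · rw [RCLike.inner_apply, mul_comm]
  · rw [inner_zero_right]

theorem inner_permRep_sum_single {G X : Type*} [Group G] [MulAction G X] [DecidableEq X] (g : G)
    (S : Finset X) (a : X → ℂ) :
    inner ℂ (∑ x ∈ S, lp.single 2 x (a x) : L2 X) (permRep G X g (∑ x ∈ S, lp.single 2 x (a x))) =
      ∑ x ∈ S, ∑ y ∈ S, if x = g • y then conj (a x) * a y else 0 := by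
  simp only [map_sum, permRep_single, sum_inner]
  simp only [inner_sum, inner_single_single]

/-! ### Representations of amenable groups are weakly contained in the regular one -/

/-- A discrete group with Følner sets. -/
def HasFolnerSets (G : Type*) [Group G] [DecidableEq G] : Prop :=
  ∀ (K : Finset G) (ε : ℝ), 0 < ε → ∃ F : Finset G, F.Nonempty ∧
    ∀ g ∈ K, ((F.filter fun y => g * y ∉ F).card : ℝ) ≤ ε * F.card

/-- Parseval's identity in the finite-dimensional span of the given vectors, so that no completeness
of `H` is needed. -/
theorem exists_sum_inner_mul_inner {H ι : Type*} [NormedAddCommGroup H] [InnerProductSpace ℂ H]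
    (S : Finset ι) (u : ι → H) : ∃ (n : ℕ) (b : Fin n → H), ∀ x ∈ S, ∀ y ∈ S,
      ∑ i, inner ℂ (u x) (b i) * inner ℂ (b i) (u y) = inner ℂ (u x) (u y) := by
  let V : Submodule ℂ H := Submodule.span ℂ (u '' S)
  have : FiniteDimensional ℂ V := FiniteDimensional.span_of_finite ℂ (S.finite_toSet.image u)
  let b := stdOrthonormalBasis ℂ V
  have hmem : ∀ x ∈ S, u x ∈ V := fun x hx => Submodule.subset_span ⟨x, hx, rfl⟩
  exact ⟨_, fun i => b i, fun x hx y hy =>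
    b.sum_inner_mul_inner ⟨u x, hmem x hx⟩ ⟨u y, hmem y hy⟩⟩

/-- Cut the orbit map `x ↦ π x⁻¹ ξ` off to `F` and take its coordinates in an orthonormal basis of
the span of its values. Each `y ∈ F` with `g * y ∈ F` contributes one copy of the coefficient at
`g`, since `π (g * y)⁻¹ ξ` and `π y⁻¹ ξ` have inner product `⟨ξ, π g ξ⟩`. -/
theorem exists_regularRep_coefficients {G H : Type*} [Group G] [DecidableEq G]
    [NormedAddCommGroup H] [InnerProductSpace ℂ H] (π : G →* (H ≃ₗᵢ[ℂ] H)) (ξ : H)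
    (F : Finset G) (c : ℝ) : ∃ (n : ℕ) (ν : Fin n → L2 G), ∀ g,
      ∑ i, inner ℂ (ν i) (regularRep G g (ν i)) =
        c ^ 2 * ((F.filter fun y => g * y ∈ F).card : ℂ) * inner ℂ ξ (π g ξ) := by
  obtain ⟨n, b, hb⟩ := exists_sum_inner_mul_inner F fun x => π x⁻¹ ξ
  refine ⟨n, fun i => ∑ x ∈ F, lp.single 2 x (c * inner ℂ (b i) (π x⁻¹ ξ)), fun g => ?_⟩
  have key : ∀ x ∈ F, ∀ y ∈ F, ∑ i, (if x = g • y then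
      conj ((c : ℂ) * inner ℂ (b i) (π x⁻¹ ξ)) * (c * inner ℂ (b i) (π y⁻¹ ξ)) else 0) =
      if x = g * y then (c : ℂ) ^ 2 * inner ℂ ξ (π g ξ) else 0 := by
    intro x hx y hy
    split_ifs with h h' h'
    · have : ∀ i, conj ((c : ℂ) * inner ℂ (b i) (π x⁻¹ ξ)) * (c * inner ℂ (b i) (π y⁻¹ ξ)) =
          (c : ℂ) ^ 2 * (inner ℂ (π x⁻¹ ξ) (b i) * inner ℂ (b i) (π y⁻¹ ξ)) := by
        intro i
        rw [map_mul, inner_conj_symm, Complex.conj_ofReal]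
        ring
      simp only [this, ← Finset.mul_sum]
      rw [hb x hx y hy, show y⁻¹ = x⁻¹ * g by rw [h', mul_inv_rev]; group, map_mul]
      congr 1
      exact LinearIsometryEquiv.inner_map_map _ _ _
    · exact absurd h h'
    · exact absurd h' h
    · simp
  simp only [regularRep, inner_permRep_sum_single]
  rw [Finset.sum_comm]
  rw [Finset.sum_congr rfl fun x hx => Finset.sum_comm.trans
    (Finset.sum_congr rfl fun y hy => key x hx y hy)]
  rw [Finset.sum_comm]
  simp only [Finset.sum_ite_eq']
  rw [← Finset.sum_filter, Finset.sum_const, nsmul_eq_mul]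
  ring

/-- Hulanicki's theorem: every unitary representation of an amenable group is weakly contained
in the regular representation. -/
theorem HasFolnerSets.weaklyContained {G H : Type*} [Group G] [DecidableEq G]
    [NormedAddCommGroup H] [InnerProductSpace ℂ H] (hG : HasFolnerSets G)
    (π : G →* (H ≃ₗᵢ[ℂ] H)) : WeaklyContained π (regularRep G) := by
  intro ε hε ξ K
  have hpos : 0 < ‖ξ‖ ^ 2 + 1 := by positivity
  -- The error will be at most the boundary ratio times `‖ξ‖ ^ 2`; the added 1 covers `ξ = 0` and
  -- the factor 1/2 makes the final inequality strict.
  obtain ⟨F, hF, hFK⟩ := hG K (ε / (‖ξ‖ ^ 2 + 1) / 2) (by positivity)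
  have hcard : (0 : ℝ) < F.card := by exact_mod_cast hF.card_pos
  obtain ⟨n, ν, hν⟩ := exists_regularRep_coefficients π ξ F (√(F.card : ℝ))⁻¹
  refine ⟨n, ν, fun g hg => ?_⟩
  have hsplit : ((F.filter fun y => g * y ∈ F).card : ℝ) +
      (F.filter fun y => g * y ∉ F).card = F.card := by
    exact_mod_cast Finset.card_filter_add_card_filter_not _
  have hc : ((((√(F.card : ℝ))⁻¹ : ℝ) : ℂ)) ^ 2 = ((F.card : ℝ)⁻¹ : ℝ) := by
    rw [← Complex.ofReal_pow, inv_pow, Real.sq_sqrt hcard.le]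
  set r : ℝ := (F.filter fun y => g * y ∉ F).card / F.card with hr
  have h1 : ((F.card : ℝ)⁻¹ : ℝ) * (F.filter fun y => g * y ∈ F).card = 1 - r := by
    rw [hr, eq_sub_iff_add_eq, inv_mul_eq_div, ← add_div, hsplit, div_self hcard.ne']
  have h2 : r ≤ ε / (‖ξ‖ ^ 2 + 1) / 2 := (div_le_iff₀ hcard).2 (hFK g hg)
  have h0 : 0 ≤ r := by positivity
  rw [hν, hc, ← Complex.ofReal_natCast, ← Complex.ofReal_mul, h1]
  rw [show inner ℂ ξ (π g ξ) - ((1 - r : ℝ) : ℂ) * inner ℂ ξ (π g ξ) =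
    (r : ℂ) * inner ℂ ξ (π g ξ) by push_cast; ring, norm_mul, Complex.norm_real,
    Real.norm_of_nonneg h0]
  have h3 : ‖inner ℂ ξ (π g ξ)‖ ≤ ‖ξ‖ ^ 2 := by
    refine (norm_inner_le_norm _ _).trans ?_
    rw [LinearIsometryEquiv.norm_map, sq]
  calc r * ‖inner ℂ ξ (π g ξ)‖ ≤ ε / (‖ξ‖ ^ 2 + 1) / 2 * (‖ξ‖ ^ 2 + 1) := by
        refine mul_le_mul h2 (h3.trans (by linarith)) (norm_nonneg _) (by positivity)
    _ = ε / 2 := by field_simp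
    _ < ε := by linarith

/-! ### Representations whose coefficients reproduce the canonical trace -/

/-- On each finite subset, the canonical trace of `G` is a sum of diagonal coefficients of `π`. -/
def ReproducesTrace {G H : Type*} [Group G] [DecidableEq G] [NormedAddCommGroup H]
    [InnerProductSpace ℂ H] (π : G →* (H ≃ₗᵢ[ℂ] H)) : Prop :=
  ∀ K : Finset G, ∃ (n : ℕ) (ν : Fin n → H),
    ∀ g ∈ K, ∑ i, inner ℂ (ν i) (π g (ν i)) = if g = 1 then 1 else 0

section

variable {G H : Type*} [Group G] [DecidableEq G] [NormedAddCommGroup H]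
  [InnerProductSpace ℂ H] {π : G →* (H ≃ₗᵢ[ℂ] H)}

/-- Replacing the basis vector at `x` by `π x (ν i)` turns a finitely supported vector of `ℓ²(G)`
into vectors of `H` whose coefficients sum to the original one. The trace has to be reproduced only
on the finite set `S⁻¹KS`. -/
theorem ReproducesTrace.exists_sum_inner (hπ : ReproducesTrace π) (S K : Finset G) (a : G → ℂ) :
    ∃ (n : ℕ) (ν : Fin n → H), ∀ g ∈ K,
      ∑ i, inner ℂ (∑ x ∈ S, a x • π x (ν i)) (π g (∑ x ∈ S, a x • π x (ν i))) =
        ∑ x ∈ S, ∑ y ∈ S, if x = g * y then conj (a x) * a y else 0 := by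
  obtain ⟨n, ν, hν⟩ := hπ ((S ×ˢ K ×ˢ S).image fun t => t.1⁻¹ * t.2.1 * t.2.2)
  refine ⟨n, ν, fun g hg => ?_⟩
  have key : ∀ x ∈ S, ∀ y ∈ S, ∑ i, inner ℂ (a x • π x (ν i)) (π g (a y • π y (ν i))) =
      if x = g * y then conj (a x) * a y else 0 := by
    intro x hx y hy
    have h1 : ∀ i, inner ℂ (a x • π x (ν i)) (π g (a y • π y (ν i))) =
        conj (a x) * a y * inner ℂ (ν i) (π (x⁻¹ * g * y) (ν i)) := by
      intro i
      rw [map_smul, inner_smul_left, inner_smul_right, mul_assoc,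
        ← LinearIsometryEquiv.inner_map_map (π x) (ν i)]
      refine congrArg (fun u : H => conj (a x) * (a y * inner ℂ (π x (ν i)) u)) ?_
      change (π g * π y) (ν i) = (π x * π (x⁻¹ * g * y)) (ν i)
      rw [← map_mul, ← map_mul]
      congr 2
      group
    have h2 : x⁻¹ * g * y = 1 ↔ x = g * y := by
      rw [mul_assoc, inv_mul_eq_one]
    simp only [h1, ← Finset.mul_sum]
    rw [hν _ (Finset.mem_image.2 ⟨(x, g, y), by simp [hx, hg, hy], rfl⟩)]
    simp only [h2, mul_ite, mul_one, mul_zero]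
  simp only [map_sum, sum_inner]
  simp only [inner_sum]
  rw [Finset.sum_comm]
  exact Finset.sum_congr rfl fun x hx => Finset.sum_comm.trans
    (Finset.sum_congr rfl fun y hy => key x hx y hy)

/-- Finitely supported vectors are dense in `ℓ²(G)`, and their coefficients are matched exactly; the
only error comes from truncating `ξ`. -/
theorem ReproducesTrace.weaklyContained (hπ : ReproducesTrace π) :
    WeaklyContained (regularRep G) π := by
  intro ε hε ξ K
  have hlim : ∀ g, Filter.Tendsto (fun S : Finset G =>
      inner ℂ (∑ x ∈ S, lp.single 2 x (ξ x) : L2 G)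
        (regularRep G g (∑ x ∈ S, lp.single 2 x (ξ x)))) Filter.atTop
      (nhds (inner ℂ ξ (regularRep G g ξ))) := by
    intro g
    have h : Filter.Tendsto (fun S : Finset G => (∑ x ∈ S, lp.single 2 x (ξ x) : L2 G))
        Filter.atTop (nhds ξ) := lp.hasSum_single (by simp) ξ
    exact h.inner (((regularRep G g).continuous.tendsto ξ).comp h)
  have hev : ∀ᶠ S : Finset G in Filter.atTop, ∀ g ∈ K,
      ‖inner ℂ ξ (regularRep G g ξ) - inner ℂ (∑ x ∈ S, lp.single 2 x (ξ x) : L2 G)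
        (regularRep G g (∑ x ∈ S, lp.single 2 x (ξ x)))‖ < ε := by
    rw [Filter.eventually_all_finset]
    intro g _
    filter_upwards [(Metric.tendsto_nhds.1 (hlim g)) ε hε] with S hS
    rwa [dist_comm, dist_eq_norm] at hS
  obtain ⟨S, hS⟩ := hev.exists
  obtain ⟨n, ν, hν⟩ := hπ.exists_sum_inner S K ξ
  refine ⟨n, fun i => ∑ x ∈ S, ξ x • π x (ν i), fun g hg => ?_⟩
  have h := hS g hg
  rw [regularRep, inner_permRep_sum_single] at h
  rw [hν g hg]
  exact h

theorem ReproducesTrace.injective (hπ : ReproducesTrace π) :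
    Function.Injective (groupAlgebraRep π) := by
  rw [injective_iff_map_eq_zero]
  intro a ha
  -- At the identity, the squared norms of the images of the `ν i` under the operator of `a` add up
  -- to `∑ ‖a x‖ ^ 2`, which must vanish if the operator does.
  obtain ⟨n, ν, hν⟩ := hπ.exists_sum_inner a.coeff.support {1} a.coeff
  have h0 : ∀ i, ∑ x ∈ a.coeff.support, a.coeff x • π x (ν i) = 0 := by
    intro i
    have := congrArg (fun T : H →L[ℂ] H => T (ν i)) ha
    simpa [groupAlgebraRep, MonoidAlgebra.lift_apply, Finsupp.sum] using this
  have h1 := hν 1 (by simp)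
  simp only [h0, one_mul, map_zero, inner_zero_right, Finset.sum_const_zero,
    Finset.sum_ite_eq] at h1
  rw [Finset.sum_congr rfl fun x hx => if_pos hx] at h1
  have h2 : ∑ x ∈ a.coeff.support, ‖a.coeff x‖ ^ 2 = 0 := by
    have : ∀ x, conj (a.coeff x) * a.coeff x = ((‖a.coeff x‖ ^ 2 : ℝ) : ℂ) := fun x => by
      rw [Complex.conj_mul']; push_cast; rfl
    simp only [this, ← Complex.ofReal_sum] at h1
    exact_mod_cast h1.symm
  rw [Finset.sum_eq_zero_iff_of_nonneg fun _ _ => by positivity] at h2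
  ext x
  by_contra hx
  have := h2 x (Finsupp.mem_support_iff.2 hx)
  simp at this
  exact hx this

end

/-! ### Følner sets of `G` -/

theorem card_filter_add_notMem_Ico_le (N : ℕ) (k : ℤ) :
    ((Finset.Ico (0 : ℤ) N).filter fun t => k + t ∉ Finset.Ico (0 : ℤ) N).card ≤ k.natAbs := by
  have : ((Finset.Ico (0 : ℤ) N).filter fun t => k + t ∉ Finset.Ico (0 : ℤ) N) ⊆
      Finset.Ico 0 (-k) ∪ Finset.Ico (N - k) N := by
    intro t ht
    simp only [Finset.mem_filter, Finset.mem_Ico, Finset.mem_union] at ht ⊢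
    omega
  refine (Finset.card_le_card this).trans ((Finset.card_union_le _ _).trans ?_)
  simp only [Int.card_Ico]
  omega

open Classical in
theorem hasFolnerSets_groupG : HasFolnerSets groupG := by
  intro K ε hε
  have := Fintype.ofFinite groupH
  let κ (g : groupG) : ℤ := (paramEquiv.symm g).2.toAdd
  let M : ℕ := ∑ g ∈ K, (κ g).natAbs
  -- Translation by `g` pushes at most `M` integers out of the interval `[0, N)`, and nothing out of
  -- the full factor `H`, so the boundary ratio is at most `M / N`.
  obtain ⟨N, hN⟩ := exists_nat_gt (M / ε)
  have hN0 : 0 < N := by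
    have : (0 : ℝ) < N := lt_of_le_of_lt (by positivity) hN
    exact_mod_cast this
  let f : groupH × ℤ → groupG := fun x => paramEquiv (x.1, .ofAdd x.2)
  have hf : Function.Injective f := fun x y h => by
    have h' := paramEquiv.injective h
    simp only [Prod.mk.injEq, Multiplicative.ofAdd.injective.eq_iff] at h'
    exact Prod.ext h'.1 h'.2
  let F : Finset groupG := (Finset.univ ×ˢ Finset.Ico (0 : ℤ) N).image f
  have hF : F.card = Fintype.card groupH * N := by
    rw [Finset.card_image_of_injective _ hf, Finset.card_product]
    simp
  have hpos : 0 < Fintype.card groupH := Fintype.card_pos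
  refine ⟨F, Finset.card_pos.1 (by rw [hF]; positivity), fun g hg => ?_⟩
  have hsub : (F.filter fun y => g * y ∉ F) ⊆ (Finset.univ ×ˢ
      (Finset.Ico (0 : ℤ) N).filter fun t => κ g + t ∉ Finset.Ico (0 : ℤ) N).image f := by
    intro y hy
    obtain ⟨hy, hgy⟩ := Finset.mem_filter.1 hy
    obtain ⟨⟨h, t⟩, ht, rfl⟩ := Finset.mem_image.1 hy
    refine Finset.mem_image.2 ⟨(h, t), ?_, rfl⟩
    simp only [Finset.mem_product, Finset.mem_univ, true_and] at ht
    simp only [Finset.mem_product, Finset.mem_univ, true_and, Finset.mem_filter]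
    refine ⟨ht, fun hk => hgy (Finset.mem_image.2
      ⟨((paramEquiv.symm g).1 * h, κ g + t), by simpa using hk, ?_⟩)⟩
    apply paramEquiv.symm.injective
    rw [map_mul]
    simp only [f, MulEquiv.symm_apply_apply]
    ext1 <;> simp [κ]
  have hle : (F.filter fun y => g * y ∉ F).card ≤ Fintype.card groupH * M := by
    refine (Finset.card_le_card hsub).trans (Finset.card_image_le.trans ?_)
    rw [Finset.card_product, Finset.card_univ]
    refine Nat.mul_le_mul_left _ ((card_filter_add_notMem_Ico_le N _).trans ?_)
    exact Finset.single_le_sum (f := fun g => (κ g).natAbs) (fun _ _ => Nat.zero_le _) hg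
  have hMN : (M : ℝ) ≤ ε * N := by
    rw [div_lt_iff₀ hε] at hN
    linarith
  calc ((F.filter fun y => g * y ∉ F).card : ℝ) ≤ Fintype.card groupH * M := by exact_mod_cast hle
    _ ≤ Fintype.card groupH * (ε * N) := by gcongr
    _ = ε * F.card := by rw [hF]; push_cast; ring

/-! ### The canonical trace of `G` -/

open Classical in
theorem inner_treeRep_single (x : groupH × Multiplicative ℤ) (a b : Fin 6)
    (w : Vertex (shift sixTwo)) :
    inner ℂ (lp.single 2 (cons a w : Vertex sixTwo) 1 : L2 (Vertex sixTwo))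
      (treeRep (paramEquiv x) (lp.single 2 (cons b w : Vertex sixTwo) 1)) =
      if a = (x.1 : Equiv.Perm (Fin 6)) b ∧ w = odometer (shift sixTwo) ^ x.2.toAdd • w
      then 1 else 0 := by
  rw [treeRep, permRep_single, inner_single_single]
  simp only [map_one, mul_one]
  refine if_congr ?_ rfl rfl
  exact (Iff.of_eq (congrArg (_ = ·) (paramEquiv_smul_cons x b w))).trans cons_injective

open Classical in
/-- Twelve times the canonical trace of `G`, as a sum of coefficients of the tree
representation. -/
theorem treeRep_trace (K : Finset groupG) : ∃ ν : Fin 6 ⊕ Fin 3 → L2 (Vertex sixTwo),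
    ∀ g ∈ K, ∑ i, inner ℂ (ν i) (treeRep g (ν i)) = if g = 1 then 12 else 0 := by
  let κ (g : groupG) : ℤ := (paramEquiv.symm g).2.toAdd
  -- The level of `w` bounds every exponent occurring in `K`, and `n < 2 ^ n`, so each non-zero one
  -- moves `w`.
  obtain ⟨w, -, hw⟩ := exists_descendant sixTwo_shift_pos root (∑ g ∈ K, (κ g).natAbs)
  let e (a : Fin 6) : L2 (Vertex sixTwo) := lp.single 2 (cons a w : Vertex sixTwo) 1
  refine ⟨Sum.elim e fun p => e (blockFst p) - e (blockSnd p), fun g hg => ?_⟩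
  have hlt : (κ g).natAbs < 2 ^ level w := by
    refine lt_of_le_of_lt ?_ Nat.lt_two_pow_self
    exact (Finset.single_le_sum (f := fun g => (κ g).natAbs) (fun _ _ => Nat.zero_le _) hg).trans hw
  have he (a b : Fin 6) : inner ℂ (e a) (treeRep g (e b)) =
      if a = ((paramEquiv.symm g).1 : Equiv.Perm (Fin 6)) b ∧
        w = odometer (shift sixTwo) ^ κ g • w then (1 : ℂ) else 0 := by
    have := inner_treeRep_single (paramEquiv.symm g) a b w
    rwa [MulEquiv.apply_symm_apply] at this
  have hone : g = 1 ↔ ((paramEquiv.symm g).1 : Equiv.Perm (Fin 6)) = 1 ∧ κ g = 0 := by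
    rw [← paramEquiv.symm.injective.eq_iff, map_one, Prod.ext_iff, OneMemClass.coe_eq_one]
    exact Iff.rfl
  simp only [Fintype.sum_sum_type, Sum.elim_inl, Sum.elim_inr, map_sub, inner_sub_left,
    inner_sub_right, he, hone]
  -- With zero exponent only the identity on the regular character of `H` remains; otherwise `w` is
  -- moved and every coefficient vanishes.
  by_cases hk : κ g = 0
  · have h := groupH_trace (paramEquiv.symm g).1.2
    have h' := congrArg (Int.cast : ℤ → ℂ) h
    push_cast at h'
    simp only [hk, zpow_zero, one_smul, and_true]
    rw [← h']
    congr 1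
    refine Finset.sum_congr rfl fun p _ => ?_
    ring
  · have := odometer_zpow_smul_ne hk hlt
    simp [hk, this.symm]

open Classical in
theorem reproducesTrace_treeRep : ReproducesTrace treeRep := by
  intro K
  obtain ⟨ν, hν⟩ := treeRep_trace K
  obtain ⟨c, hc⟩ : ∃ c : ℂ, c * conj c = 12⁻¹ := by
    refine ⟨((√12)⁻¹ : ℝ), ?_⟩
    rw [Complex.conj_ofReal, ← Complex.ofReal_mul, ← mul_inv, Real.mul_self_sqrt (by norm_num)]
    norm_num
  -- Six basis vectors and three block differences, rescaled by `1/√12` to normalize the trace.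
  refine ⟨9, fun i => c • ν (finSumFinEquiv.symm i), fun g hg => ?_⟩
  have h := hν g hg
  rw [← finSumFinEquiv.symm.sum_comp] at h
  simp only [map_smul, inner_smul_left, inner_smul_right, ← mul_assoc, hc, ← Finset.mul_sum]
  refine (congrArg (_ * ·) h).trans ?_
  split_ifs <;> norm_num

theorem weaklyEquivalent_treeRep : WeaklyEquivalent treeRep (regularRep groupG) := by
  classical
  exact ⟨hasFolnerSets_groupG.weaklyContained treeRep, reproducesTrace_treeRep.weaklyContained⟩

theorem injective_treeRep : Function.Injective (groupAlgebraRep treeRep) := by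
  classical
  exact reproducesTrace_treeRep.injective

/-! ### Remaining hypotheses of the two refuted implications -/

theorem countable_groupG : Countable groupG := paramEquiv.symm.injective.countable

theorem two_le_sixTwo (n : ℕ) : 2 ≤ sixTwo n := by
  cases n
  · exact Nat.le_of_ble_eq_true rfl
  · exact le_rfl

theorem exists_subtreeStabilizer_groupG_ne_bot : ∃ v, subtreeStabilizer groupG v ≠ ⊥ :=
  ⟨cons (0 : Fin 6) root, (subtreeStabilizer_groupG fun h => by cases h).1⟩

end TreeRep

theorem mainTheorem10 :
    -- `H` is a non-trivial semidirect product of `ℤ/3` acting on `(ℤ/2)²`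
    (∃ φ : Multiplicative (ZMod 3) →* MulAut (Multiplicative (ZMod 2 × ZMod 2)), φ ≠ 1 ∧
      Nonempty (TreeRep.groupH ≃*
        Multiplicative (ZMod 2 × ZMod 2) ⋊[φ] Multiplicative (ZMod 3))) ∧
    -- `G = H ⊕ ℤ`
    (∃ e : TreeRep.groupH × Multiplicative ℤ ≃* TreeRep.groupG,
      (∀ h : TreeRep.groupH,
        (e (h, 1) : TreeRep.treeAut TreeRep.sixTwo) = TreeRep.liftPerm h) ∧
      ∀ k : ℤ,
        (e (1, Multiplicative.ofAdd k) : TreeRep.treeAut TreeRep.sixTwo) = TreeRep.sBar ^ k) ∧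
    -- `G` acts spherically transitively
    TreeRep.SphericallyTransitive TreeRep.groupG ∧
    -- the stabilizers of proper subtrees are non-trivial, finite, non-central and have a
    -- normalizer of finite index in `G`
    (∀ v : TreeRep.Vertex TreeRep.sixTwo, v ≠ TreeRep.Vertex.root →
      TreeRep.subtreeStabilizer TreeRep.groupG v ≠ ⊥ ∧
      Finite (TreeRep.subtreeStabilizer TreeRep.groupG v) ∧
      ¬ TreeRep.subtreeStabilizer TreeRep.groupG v ≤ Subgroup.center TreeRep.groupG ∧
      (Subgroup.normalizer
        (TreeRep.subtreeStabilizer TreeRep.groupG v : Set TreeRep.groupG)).FiniteIndex) ∧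
    -- the tree representation is weakly equivalent to the regular representation
    TreeRep.WeaklyEquivalent TreeRep.treeRep (TreeRep.regularRep TreeRep.groupG) ∧
    -- the tree representation is faithful on the group algebra
    Function.Injective (TreeRep.groupAlgebraRep TreeRep.treeRep) ∧
    -- hence, without a hypothesis on normalizers of finite subgroups, a non-trivial subtree
    -- stabilizer of a spherically transitive action of a countable group neither forces the tree
    -- representation to be non-faithful on the group algebra, nor prevents it from weakly
    -- containing the regular representation
    (¬ ∀ (d : ℕ → ℕ) (Γ : Subgroup (TreeRep.treeAut d)), (∀ n, 2 ≤ d n) → Countable Γ →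
      TreeRep.SphericallyTransitive Γ → (∃ v, TreeRep.subtreeStabilizer Γ v ≠ ⊥) →
      ¬ Function.Injective
        (TreeRep.groupAlgebraRep (TreeRep.permRep Γ (TreeRep.Vertex d)))) ∧
    (¬ ∀ (d : ℕ → ℕ) (Γ : Subgroup (TreeRep.treeAut d)), (∀ n, 2 ≤ d n) → Countable Γ →
      TreeRep.SphericallyTransitive Γ → (∃ v, TreeRep.subtreeStabilizer Γ v ≠ ⊥) →
      ¬ TreeRep.WeaklyContained (TreeRep.regularRep Γ)
        (TreeRep.permRep Γ (TreeRep.Vertex d))) := by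

  refine ⟨TreeRep.groupH_semidirect, ⟨TreeRep.paramEquiv, fun h => TreeRep.paramHom_left h,
    TreeRep.paramHom_right⟩, TreeRep.sphericallyTransitive_groupG,
    fun v hv => TreeRep.subtreeStabilizer_groupG hv, TreeRep.weaklyEquivalent_treeRep,
    TreeRep.injective_treeRep, fun h => ?_, fun h => ?_⟩
  · exact h _ _ TreeRep.two_le_sixTwo TreeRep.countable_groupG
      TreeRep.sphericallyTransitive_groupG TreeRep.exists_subtreeStabilizer_groupG_ne_bot
      TreeRep.injective_treeRep
  · exact h _ _ TreeRep.two_le_sixTwo TreeRep.countable_groupG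
      TreeRep.sphericallyTransitive_groupG TreeRep.exists_subtreeStabilizer_groupG_ne_bot
      TreeRep.weaklyEquivalent_treeRep.2
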